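/- Let $\mathbb{Z}_+=\{0,1,2,\dots\}$ and $\mathbb{N}=\{1,2,\dots\}$, let $\Sigma=\{0,1\}^{\mathbb{Z}_+}$ carry the product topology and the metric $d(x,y)=2^{-\min\{i:\,x_i\ne y_i\}}$ for $x\neq y$ (and $d(x,x)=0$), and let $\sigma:\Sigma\to\Sigma$, $\sigma(x)_n=x_{n+1}$, be the shift. For $P\subset\mathbb{N}$ the spacing shift $X_P\subset\Sigma$ is the closed $\sigma$-invariant set of all $x\in\Sigma$ such that $x_i=x_j=1$ implies $|i-j|\in P\cup\{0\}$. The system $(X_P,\sigma)$ is weakly mixing if for all non-empty open $U,V\subset X_P\times X_P$ the set $\{n\in\mathbb{Z}_+: U\cap(\sigma\times\sigma)^{-n}V\neq\emptyset\}$ is infinite. The set $P$ is thick if for every $n\in\mathbb{N}$ there is $a\in\mathbb{N}$ with $\{a,a+1,\dots,a+n\}\subset P$. A set $F\subset\mathbb{Z}_+$ has Banach density one if for every $\lambda<1$ there is $N\ge1$ such that $\#(F\cap I)\ge\lambda\,\#(I)$ for every finite interval $I\subset\mathbb{Z}_+$ of consecutive integers with $\#(I)\ge N$. A pair $(x,y)$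 of points of $X_P$ is Banach proximal if for every $\varepsilon>0$ the set $\{n\in\mathbb{Z}_+: d(\sigma^n x,\sigma^n y)<\varepsilon\}$ has Banach density one, and asymptotic if $\lim_{n\to\infty}d(\sigma^n x,\sigma^n y)=0$. A set $S\subset X_P$ with at least two points is Banach scrambled if every two distinct points of $S$ form a Banach proximal pair that is not asymptotic. A Mycielski set is a countable union of Cantor sets, that is, of subsets homeomorphic to $\{0,1\}^{\mathbb{Z}_+}$. **Theorem 6.5.** Let $P\subset\mathbb{N}$. The spacing shift $(X_P,\sigma)$ is weakly mixing if and only if $P$ is thick. If $(X_P,\sigma)$ is weakly mixing, then there is a subset $S\subset X_P$ that is dense in $X_P$, Mycielski, $\sigma$-invariant (that is, $\sigma(S)\subset S$), and Banach scrambled. -/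

import Mathlib

namespace SpacingShift

open Filter Topology

/-! ### Subsets of the non-negative integers -/

/-- `F` has Banach density one: for every `lam < 1` there is `N ≥ 1` such that
`#(F ∩ I) ≥ lam * #I` for every (finite) interval `I = {a, …, a + m - 1}` with `#I = m ≥ N`. -/
def HasBanachDensityOne (F : Set ℕ) : Prop :=
  ∀ lam : ℝ, lam < 1 → ∃ N : ℕ, 1 ≤ N ∧ ∀ a m : ℕ, N ≤ m →
    lam * (m : ℝ) ≤ ((F ∩ Set.Ico a (a + m)).ncard : ℝ)

/-- `P` is thick: for every `n ≥ 1` there is `a ≥ 1` with `{a, a + 1, …, a + n} ⊆ P`. -/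
def IsThick (P : Set ℕ) : Prop :=
  ∀ n : ℕ, 1 ≤ n → ∃ a : ℕ, 1 ≤ a ∧ Set.Icc a (a + n) ⊆ P

/-! ### Dynamical notions for a self-map `T` of a space `X` -/

/-- `N(U, V) = {n ≥ 0 : U ∩ T⁻ⁿ V ≠ ∅}`. -/
def hittingTimes {X : Type*} (T : X → X) (U V : Set X) : Set ℕ :=
  {n | (U ∩ T^[n] ⁻¹' V).Nonempty}

/-- `T` is (topologically) transitive: `N(U, V)` is infinite for all non-empty open `U`, `V`. -/
def IsTransitive {X : Type*} [TopologicalSpace X] (T : X → X) : Prop :=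
  ∀ U V : Set X, IsOpen U → U.Nonempty → IsOpen V → V.Nonempty → (hittingTimes T U V).Infinite

/-- `T` is weakly mixing: `T × T` is transitive. -/
def IsWeaklyMixing {X : Type*} [TopologicalSpace X] (T : X → X) : Prop :=
  IsTransitive (Prod.map T T)

/-- `(x, y)` is a Banach proximal pair of `T`. -/
def IsBanachProximal {X : Type*} [MetricSpace X] (T : X → X) (x y : X) : Prop :=
  ∀ ε : ℝ, 0 < ε → HasBanachDensityOne {n : ℕ | dist (T^[n] x) (T^[n] y) < ε}

/-- `(x, y)` is an asymptotic pair of `T`. -/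
def IsAsymptotic {X : Type*} [MetricSpace X] (T : X → X) (x y : X) : Prop :=
  Tendsto (fun n : ℕ => dist (T^[n] x) (T^[n] y)) atTop (𝓝 0)

/-- `S` has at least two points, and any two distinct points of `S` form a Banach proximal pair
that is not asymptotic. -/
def IsBanachScrambled {X : Type*} [MetricSpace X] (T : X → X) (S : Set X) : Prop :=
  S.Nontrivial ∧ ∀ x ∈ S, ∀ y ∈ S, x ≠ y → IsBanachProximal T x y ∧ ¬ IsAsymptotic T x y

/-- A Cantor set: a subset homeomorphic to the Cantor space `{0,1}^ℕ`. -/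
def IsCantorSet {X : Type*} [TopologicalSpace X] (C : Set X) : Prop :=
  Nonempty (C ≃ₜ (ℕ → Bool))

/-- A Mycielski set: a countable union of Cantor sets. -/
def IsMycielski {X : Type*} [TopologicalSpace X] (K : Set X) : Prop :=
  ∃ C : ℕ → Set X, (∀ n, IsCantorSet (C n)) ∧ K = ⋃ n, C n

/-! ### Spacing shifts -/

/-- The standard metric on `{0,1}^ℕ`: `d(x, y) = 2^(-n)`, `n` the first index where `x` and `y`
differ. It induces the product topology (and uniformity). -/
noncomputable instance instMetricSpaceSeq : MetricSpace (ℕ → Bool) :=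
  PiNat.metricSpaceOfDiscreteUniformity (fun _ => rfl)

/-- The spacing shift `X_P`: all `x ∈ {0,1}^ℕ` such that `x_i = x_j = 1` implies
`|i - j| ∈ P ∪ {0}`; it is closed and shift invariant. The symbols `0`, `1` are
`false`, `true`, and `Nat.dist i j` is `|i - j|`. -/
def spacingShift (P : Set ℕ) : SymbolicDynamics.FullShift.Subshift Bool ℕ where
  carrier := {x | ∀ i j : ℕ, x i = true → x j = true → Nat.dist i j ∈ P ∪ {0}}
  isClosed := by
    simp only [Set.ofPred_forall]
    refine isClosed_iInter fun i => isClosed_iInter fun j => ?_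
    have h : ∀ k : ℕ, IsClopen {x : ℕ → Bool | x k = true} := fun k =>
      (isClopen_discrete {true}).preimage (continuous_apply k)
    exact isClosed_imp (h i).isOpen (isClosed_imp (h j).isOpen isClosed_const)
  mapsTo := by
    intro g x hx i j hi hj
    have := hx (g + i) (g + j) hi hj
    rwa [Nat.dist_add_add_left] at this

/-- The phase space of the dynamical system `(X_P, σ)`, with the metric and the topology
inherited from `{0,1}^ℕ`. -/
abbrev Space (P : Set ℕ) : Type := (spacingShift P).carrier

/-- The shift `σ(x)_n = x_{n+1}` as a self-map of `X_P`. -/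
def shiftMap (P : Set ℕ) : Space P → Space P :=
  ((spacingShift P).mapsTo 1).restrict (SymbolicDynamics.FullShift.shift 1) _ _

theorem shiftMap_apply (P : Set ℕ) (x : Space P) (n : ℕ) :
    (shiftMap P x).1 n = x.1 (n + 1) := by
  simp [shiftMap, Nat.add_comm]

end SpacingShift

namespace SpacingShift

open Filter Topology

/-! If the shift is weakly mixing, Furstenberg's intersection argument
(`exists_hittingTimes_subset`) puts a common positive time `k` in the hitting sets from `[1]` at 0
to `[1]` at `i`, for all `i ≤ n`; then `k + i ∈ P`. Conversely, a long run in `P` lets one follow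
any prefix by any other after a suitable delay (`exists_concat`).

For the scrambled set, thickness yields a skeleton `a` with growing gaps along which ones may be
placed freely. Each point copies a prefix of a member of a dense sequence, then carries ones along a
subset of the skeleton indexed by an almost disjoint family. Growing gaps leave `O(√m)` ones in any
interval of length `m`, so all pairs are Banach proximal. Almost disjointness, together with the
gaps, makes points with different labels (tag, parameter, shift) differ infinitely often
(`frequently_ne`), which gives both injectivity and non-asymptoticity. Taking all shifts gives
invariance. -/

/-! ### Sets with few elements in every interval -/

/-- `B` meets every interval of length `m` in `O(√m)` points. -/
def IsSqrtSparse (B : Set ℕ) : Prop :=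
  ∃ C : ℕ, ∀ a m : ℕ, (B ∩ Set.Ico a (a + m)).ncard ≤ C * (Nat.sqrt m + 1)

theorem finite_inter_Ico (B : Set ℕ) (a b : ℕ) : (B ∩ Set.Ico a b).Finite :=
  (Set.finite_Ico a b).subset Set.inter_subset_right

theorem IsSqrtSparse.mono {A B : Set ℕ} (hB : IsSqrtSparse B) (h : A ⊆ B) : IsSqrtSparse A := by
  obtain ⟨C, hC⟩ := hB
  exact ⟨C, fun a m => (Set.ncard_le_ncard (Set.inter_subset_inter_left _ h)
    (finite_inter_Ico _ _ _)).trans (hC a m)⟩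

theorem IsSqrtSparse.union {A B : Set ℕ} (hA : IsSqrtSparse A) (hB : IsSqrtSparse B) :
    IsSqrtSparse (A ∪ B) := by
  obtain ⟨C, hC⟩ := hA
  obtain ⟨D, hD⟩ := hB
  refine ⟨C + D, fun a m => ?_⟩
  rw [Set.union_inter_distrib_right, add_mul]
  exact (Set.ncard_union_le _ _).trans (add_le_add (hC a m) (hD a m))

theorem isSqrtSparse_of_finite {B : Set ℕ} (hB : B.Finite) : IsSqrtSparse B := by
  refine ⟨B.ncard, fun a m => ?_⟩
  exact (Set.ncard_le_ncard Set.inter_subset_left hB).trans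
    (Nat.le_mul_of_pos_right _ (Nat.succ_pos _))

theorem IsSqrtSparse.preimage_add {B : Set ℕ} (hB : IsSqrtSparse B) (k : ℕ) :
    IsSqrtSparse {n | n + k ∈ B} := by
  obtain ⟨C, hC⟩ := hB
  refine ⟨C, fun a m => le_trans ?_ (hC (a + k) m)⟩
  refine Set.ncard_le_ncard_of_injOn (fun n => n + k) ?_ (fun x _ y _ h => by simpa using h)
    (finite_inter_Ico _ _ _)
  rintro n ⟨hn, h1, h2⟩
  exact ⟨hn, Nat.add_le_add_right h1 k, by show n + k < a + k + m; omega⟩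

/-- A union of `L` translates. It bounds the times at which a window of length `L` meets `B`. -/
theorem IsSqrtSparse.exists_add_mem {B : Set ℕ} (hB : IsSqrtSparse B) (L : ℕ) :
    IsSqrtSparse {n | ∃ i < L, n + i ∈ B} := by
  induction L with
  | zero => exact (isSqrtSparse_of_finite Set.finite_empty).mono (by simp)
  | succ L ih =>
    refine (ih.union (hB.preimage_add L)).mono ?_
    rintro n ⟨i, hi, hn⟩
    rcases Nat.lt_succ_iff_lt_or_eq.mp hi with h | rfl
    · exact Or.inl ⟨i, h, hn⟩
    · exact Or.inr hn

theorem add_sq_le_of_gaps {a : ℕ → ℕ} (ha : ∀ n, a n + 2 * n + 1 ≤ a (n + 1)) (p d : ℕ) :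
    a p + d ^ 2 ≤ a (p + d) := by
  induction d with
  | zero => simp
  | succ d ih =>
    have := ha (p + d)
    rw [← add_assoc]
    nlinarith

/-- If `a p` is the first term in the interval, `a (p + d)` lies at least `d ^ 2` further on, so
only `d ≤ √m` can occur. -/
theorem isSqrtSparse_range {a : ℕ → ℕ} (ha : ∀ n, a n + 2 * n + 1 ≤ a (n + 1)) :
    IsSqrtSparse (Set.range a) := by
  classical
  refine ⟨1, fun b m => ?_⟩
  by_cases h : ∃ n, a n ∈ Set.Ico b (b + m)
  · have hsub : Set.range a ∩ Set.Ico b (b + m) ⊆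
        a '' (Set.Ico (Nat.find h) (Nat.find h + (Nat.sqrt m + 1))) := by
      rintro _ ⟨⟨n, rfl⟩, hn⟩
      refine ⟨n, ⟨Nat.find_min' h hn, ?_⟩, rfl⟩
      obtain ⟨d, hd⟩ := Nat.exists_eq_add_of_le (Nat.find_min' h hn)
      have h1 := add_sq_le_of_gaps ha (Nat.find h) d
      rw [← hd] at h1
      have h2 := (Nat.find_spec h).1
      have h3 := hn.2
      have : d ≤ Nat.sqrt m := Nat.le_sqrt'.mpr (by omega)
      omega
    refine (Set.ncard_le_ncard hsub ((Set.finite_Ico _ _).image _)).trans ?_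
    refine (Set.ncard_image_le (Set.finite_Ico _ _)).trans ?_
    simp [Set.ncard_eq_toFinset_card']
  · have : Set.range a ∩ Set.Ico b (b + m) = ∅ := by
      rw [Set.eq_empty_iff_forall_notMem]
      rintro _ ⟨⟨n, rfl⟩, hn⟩
      exact h ⟨n, hn⟩
    simp [this]

theorem IsSqrtSparse.hasBanachDensityOne {B F : Set ℕ} (hB : IsSqrtSparse B)
    (h : ∀ n, n ∉ B → n ∈ F) : HasBanachDensityOne F := by
  obtain ⟨C, hC⟩ := hB
  intro lam hlam
  -- Once `√m ≥ max K 1`, this gives `C (√m + 1) ≤ 2 C √m ≤ K (1 - lam) √m ≤ (1 - lam) m`.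
  obtain ⟨K, hK⟩ := exists_nat_gt (2 * (C : ℝ) / (1 - lam))
  have hpos : 0 < 1 - lam := by linarith
  rw [div_lt_iff₀ hpos] at hK
  refine ⟨K ^ 2 + 1, by omega, fun a m hm => ?_⟩
  have hs : K ≤ Nat.sqrt m := Nat.le_sqrt'.mpr (by omega)
  have hs1 : 1 ≤ Nat.sqrt m := Nat.le_sqrt'.mpr (by omega)
  have hsm : Nat.sqrt m ^ 2 ≤ m := Nat.sqrt_le' m
  have hcard : m ≤ (B ∩ Set.Ico a (a + m)).ncard + (F ∩ Set.Ico a (a + m)).ncard := by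
    have h1 : (Set.Ico a (a + m)).ncard = m := by simp [Set.ncard_eq_toFinset_card']
    conv_lhs => rw [← h1]
    refine le_trans (Set.ncard_le_ncard ?_
      ((finite_inter_Ico _ _ _).union (finite_inter_Ico _ _ _))) (Set.ncard_union_le _ _)
    intro n hn
    by_cases hb : n ∈ B
    · exact Or.inl ⟨hb, hn⟩
    · exact Or.inr ⟨h n hb, hn⟩
  have hle := hC a m
  have e1 : (m : ℝ) ≤ C * (Nat.sqrt m + 1) + ((F ∩ Set.Ico a (a + m)).ncard : ℝ) := by
    exact_mod_cast hcard.trans (by omega)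
  have e2 : (K : ℝ) ≤ Nat.sqrt m := by exact_mod_cast hs
  have e3 : (1 : ℝ) ≤ Nat.sqrt m := by exact_mod_cast hs1
  have e4 : (Nat.sqrt m : ℝ) ^ 2 ≤ m := by exact_mod_cast hsm
  have e5 : (C : ℝ) * (Nat.sqrt m + 1) ≤ (1 - lam) * m := by
    have hC0 : (0 : ℝ) ≤ C := Nat.cast_nonneg C
    calc (C : ℝ) * (Nat.sqrt m + 1) ≤ 2 * C * Nat.sqrt m := by nlinarith
      _ ≤ (K * (1 - lam)) * Nat.sqrt m := by gcongr
      _ ≤ (Nat.sqrt m * (1 - lam)) * Nat.sqrt m := by gcongr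
      _ = (1 - lam) * (Nat.sqrt m) ^ 2 := by ring
      _ ≤ (1 - lam) * m := by gcongr
  linarith

/-! ### The metric and the shift on `X_P` -/

theorem dist_le_of_agree {x y : ℕ → Bool} {L : ℕ} (h : ∀ i < L, x i = y i) :
    dist x y ≤ (1 / 2 : ℝ) ^ L :=
  (PiNat.mem_cylinder_iff_dist_le (E := fun _ : ℕ => Bool)).mp fun i hi => h i hi

theorem dist_eq_one_of_ne {x y : ℕ → Bool} (h : x 0 ≠ y 0) : dist x y = 1 := by
  have hxy : x ≠ y := fun e => h (congrFun e 0)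
  have h0 : PiNat.firstDiff x y = 0 := by
    by_contra hne
    exact h (PiNat.apply_eq_of_lt_firstDiff (Nat.pos_of_ne_zero hne))
  have := PiNat.dist_eq_of_ne (E := fun _ : ℕ => Bool) hxy
  rw [h0, pow_zero] at this
  exact this

theorem shiftMap_iterate_apply (P : Set ℕ) (n : ℕ) (x : Space P) (i : ℕ) :
    ((shiftMap P)^[n] x).1 i = x.1 (i + n) := by
  induction n generalizing i with
  | zero => rfl
  | succ n ih =>
    rw [Function.iterate_succ_apply', shiftMap_apply, ih, add_assoc, add_comm 1 n]

theorem continuous_shiftMap (P : Set ℕ) : Continuous (shiftMap P) := by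
  refine Continuous.subtype_mk (f := fun x : Space P => (shiftMap P x).1) ?_ _
  refine continuous_pi fun i => ?_
  simp only [shiftMap_apply]
  exact (continuous_apply (i + 1)).comp continuous_subtype_val

theorem exists_cylinder_subset {P : Set ℕ} {U : Set (Space P)} (hU : IsOpen U) {x : Space P}
    (hx : x ∈ U) : ∃ L : ℕ, ∀ y : Space P, (∀ i < L, y.1 i = x.1 i) → y ∈ U := by
  obtain ⟨ε, hε, hb⟩ := Metric.isOpen_iff.mp hU x hx
  obtain ⟨L, hL⟩ := exists_pow_lt_of_lt_one hε (by norm_num : (1 / 2 : ℝ) < 1)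
  exact ⟨L, fun y hy => hb ((dist_le_of_agree hy).trans_lt hL)⟩

/-- Outside a sparse set of times, both points show a block of `L` zeros and hence are close. -/
theorem isBanachProximal_of_isSqrtSparse {P : Set ℕ} {x y : Space P}
    (hx : IsSqrtSparse {n | x.1 n = true}) (hy : IsSqrtSparse {n | y.1 n = true}) :
    IsBanachProximal (shiftMap P) x y := by
  intro ε hε
  obtain ⟨L, hL⟩ := exists_pow_lt_of_lt_one hε (by norm_num : (1 / 2 : ℝ) < 1)
  refine ((hx.union hy).exists_add_mem L).hasBanachDensityOne fun n hn => ?_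
  refine (dist_le_of_agree fun i hi => ?_).trans_lt hL
  rw [shiftMap_iterate_apply, shiftMap_iterate_apply, add_comm i n]
  have h1 : ¬ (x.1 (n + i) = true ∨ y.1 (n + i) = true) := fun h => hn ⟨i, hi, h⟩
  rw [not_or, Bool.not_eq_true, Bool.not_eq_true] at h1
  rw [h1.1, h1.2]

theorem not_isAsymptotic_of_frequently_ne {P : Set ℕ} {x y : Space P}
    (h : ∃ᶠ n in atTop, x.1 n ≠ y.1 n) : ¬ IsAsymptotic (shiftMap P) x y := by
  intro hasy
  have hev : ∀ᶠ n in atTop, dist ((shiftMap P)^[n] x) ((shiftMap P)^[n] y) < 1 :=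
    hasy.eventually (gt_mem_nhds one_pos)
  obtain ⟨n, hne, hlt⟩ := (h.and_eventually hev).exists
  refine hlt.ne (dist_eq_one_of_ne ?_)
  rwa [shiftMap_iterate_apply, shiftMap_iterate_apply, zero_add]

/-! ### Weak mixing and thickness -/

theorem IsWeaklyMixing.exists_hittingTimes_subset {X : Type*} [TopologicalSpace X] {T : X → X}
    (hT : IsWeaklyMixing T) (hc : Continuous T) {U₁ V₁ U₂ V₂ : Set X}
    (hU₁ : IsOpen U₁) (hU₁' : U₁.Nonempty) (hV₁ : IsOpen V₁) (hV₁' : V₁.Nonempty)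
    (hU₂ : IsOpen U₂) (hU₂' : U₂.Nonempty) (hV₂ : IsOpen V₂) (hV₂' : V₂.Nonempty) :
    ∃ U V : Set X, IsOpen U ∧ U.Nonempty ∧ IsOpen V ∧ V.Nonempty ∧
      hittingTimes T U V ⊆ hittingTimes T U₁ V₁ ∩ hittingTimes T U₂ V₂ := by
  -- The sources are `U₁` and `V₁`, the targets `U₂` and `V₂`: an orbit from `U₁ ∩ T⁻ⁿ U₂` to `V₁ ∩
  -- T⁻ⁿ V₂` then also realises `U₂` to `V₂`, starting at `T^[n] x`.
  obtain ⟨n, ⟨u, v⟩, ⟨hu, hv⟩, huv⟩ := (hT (U₁ ×ˢ V₁) (U₂ ×ˢ V₂) (hU₁.prod hV₁) (hU₁'.prod hV₁')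
    (hU₂.prod hV₂) (hU₂'.prod hV₂')).nonempty
  rw [Prod.map_iterate] at huv
  refine ⟨U₁ ∩ T^[n] ⁻¹' U₂, V₁ ∩ T^[n] ⁻¹' V₂, hU₁.inter (hU₂.preimage (hc.iterate n)),
    ⟨u, hu, huv.1⟩, hV₁.inter (hV₂.preimage (hc.iterate n)), ⟨v, hv, huv.2⟩, ?_⟩
  rintro k ⟨x, ⟨hx1, hx2⟩, hx3, hx4⟩
  refine ⟨⟨x, hx1, hx3⟩, ⟨T^[n] x, hx2, ?_⟩⟩
  rw [Set.mem_preimage, ← Function.iterate_add_apply, add_comm, Function.iterate_add_apply]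
  exact hx4

theorem IsWeaklyMixing.hittingTimes_infinite {X : Type*} [TopologicalSpace X] {T : X → X}
    (hT : IsWeaklyMixing T) {U V : Set X} (hU : IsOpen U) (hU' : U.Nonempty) (hV : IsOpen V)
    (hV' : V.Nonempty) : (hittingTimes T U V).Infinite := by
  refine (hT (U ×ˢ U) (V ×ˢ V) (hU.prod hU) (hU'.prod hU') (hV.prod hV) (hV'.prod hV')).mono ?_
  rintro n ⟨⟨u, v⟩, ⟨hu, -⟩, huv⟩
  rw [Prod.map_iterate] at huv
  exact ⟨u, hu, huv.1⟩

theorem isOpen_coord (P : Set ℕ) (i : ℕ) : IsOpen {x : Space P | x.1 i = true} := by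
  have hc : Continuous fun x : Space P => x.1 i :=
    (continuous_apply (A := fun _ : ℕ => Bool) i).comp continuous_subtype_val
  exact ((continuous_bool_rng true).mp hc).isOpen

theorem nonempty_coord (P : Set ℕ) (i : ℕ) : {x : Space P | x.1 i = true}.Nonempty := by
  refine ⟨⟨fun j => decide (j = i), ?_⟩, by simp⟩
  intro j k hj hk
  simp only [decide_eq_true_eq] at hj hk
  simp [hj, hk, Nat.dist_self]

theorem mem_of_mem_hittingTimes_coord {P : Set ℕ} {i n : ℕ} (hn : 0 < n)
    (h : n ∈ hittingTimes (shiftMap P) {x | x.1 0 = true} {x | x.1 i = true}) : n + i ∈ P := by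
  obtain ⟨x, hx, hx'⟩ := h
  have h2 : x.1 (i + n) = true := by rw [← shiftMap_iterate_apply]; exact hx'
  have h3 := x.2 0 (i + n) hx h2
  rw [Nat.dist_eq_sub_of_le (Nat.zero_le _), Nat.sub_zero, add_comm] at h3
  exact h3.resolve_right fun h0 => by
    have : n + i = 0 := h0
    omega

theorem isThick_of_isWeaklyMixing {P : Set ℕ} (h : IsWeaklyMixing (shiftMap P)) : IsThick P := by
  have key : ∀ n : ℕ, ∃ U V : Set (Space P), IsOpen U ∧ U.Nonempty ∧ IsOpen V ∧ V.Nonempty ∧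
      ∀ i ≤ n, hittingTimes (shiftMap P) U V ⊆
        hittingTimes (shiftMap P) {x | x.1 0 = true} {x | x.1 i = true} := by
    intro n
    induction n with
    | zero =>
      refine ⟨_, _, isOpen_coord P 0, nonempty_coord P 0, isOpen_coord P 0, nonempty_coord P 0, ?_⟩
      intro i hi
      obtain rfl := Nat.le_zero.mp hi
      exact subset_rfl
    | succ n ih =>
      obtain ⟨U, V, hU, hU', hV, hV', hUV⟩ := ih
      obtain ⟨U₁, V₁, h1, h2, h3, h4, h5⟩ := h.exists_hittingTimes_subset (continuous_shiftMap P)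
        hU hU' hV hV' (isOpen_coord P 0) (nonempty_coord P 0) (isOpen_coord P (n + 1))
        (nonempty_coord P (n + 1))
      refine ⟨U₁, V₁, h1, h2, h3, h4, fun i hi => ?_⟩
      rcases Nat.le_succ_iff.mp hi with hi | rfl
      · exact (h5.trans Set.inter_subset_left).trans (hUV i hi)
      · exact h5.trans Set.inter_subset_right
  intro n _
  obtain ⟨U, V, hU, hU', hV, hV', hUV⟩ := key n
  obtain ⟨k, hk, hk0⟩ := (h.hittingTimes_infinite hU hU' hV hV').exists_gt 0
  refine ⟨k, hk0, fun l hl => ?_⟩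
  obtain ⟨i, rfl⟩ := Nat.exists_eq_add_of_le hl.1
  exact mem_of_mem_hittingTimes_coord hk0 (hUV i (by have := hl.2; omega) hk)

theorem IsThick.exists_window {P : Set ℕ} (hP : IsThick P) (L N : ℕ) :
    ∃ n, N ≤ n ∧ ∀ k, n ≤ k + L → k ≤ n + L → k ∈ P := by
  obtain ⟨a, -, ha⟩ := hP (2 * L + N + 1) (by omega)
  -- The centre sits `N` further right than necessary inside the run, which forces `n ≥ N`.
  exact ⟨a + L + N, by omega, fun k h1 h2 => ha ⟨by omega, by omega⟩⟩

theorem mem_carrier_of_lt {P : Set ℕ} {x : ℕ → Bool}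
    (h : ∀ i j, i < j → x i = true → x j = true → j - i ∈ P) : x ∈ (spacingShift P).carrier := by
  intro i j hi hj
  rcases lt_trichotomy i j with hij | rfl | hij
  · rw [Nat.dist_eq_sub_of_le hij.le]
    exact Or.inl (h i j hij hi hj)
  · rw [Nat.dist_self]
    exact Or.inr rfl
  · rw [Nat.dist_eq_sub_of_le_right hij.le]
    exact Or.inl (h j i hij hj hi)

theorem mem_of_ones {P : Set ℕ} (x : Space P) {i j : ℕ} (hij : i < j) (hi : x.1 i = true)
    (hj : x.1 j = true) : j - i ∈ P := by
  have h := x.2 i j hi hj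
  rw [Nat.dist_eq_sub_of_le hij.le] at h
  exact h.resolve_right fun h0 => by
    have : j - i = 0 := h0
    omega

theorem exists_concat {P : Set ℕ} (x y : Space P) {L n : ℕ} (hn : L ≤ n)
    (hP : ∀ k, n ≤ k + L → k ≤ n + L → k ∈ P) :
    ∃ z : Space P, (∀ i < L, z.1 i = x.1 i) ∧
      ∀ i < L, ((shiftMap P)^[n] z).1 i = y.1 i := by
  refine ⟨⟨fun i => (decide (i < L) && x.1 i) || (decide (n ≤ i ∧ i < n + L) && y.1 (i - n)), ?_⟩,
    fun i hi => ?_, fun i hi => ?_⟩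
  · refine mem_carrier_of_lt fun i j hij hi hj => ?_
    simp only [Bool.or_eq_true, Bool.and_eq_true, decide_eq_true_eq] at hi hj
    rcases hi with ⟨hi, hi'⟩ | ⟨hi, hi'⟩ <;> rcases hj with ⟨hj, hj'⟩ | ⟨hj, hj'⟩
    · exact mem_of_ones x hij hi' hj'
    -- A one in the prefix and a one in the copy are at a distance within `L` of `n`.
    · exact hP _ (by omega) (by omega)
    · omega
    · have := mem_of_ones y (i := i - n) (j := j - n) (by omega) hi' hj'
      rwa [show j - n - (i - n) = j - i by omega] at this
  · have h1 : ¬ n ≤ i := by omega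
    simp [hi, h1]
  · rw [shiftMap_iterate_apply]
    have h1 : ¬ i + n < L := by omega
    have h2 : i + n < n + L := by omega
    simp [h1, h2]

theorem isWeaklyMixing_of_isThick {P : Set ℕ} (hP : IsThick P) :
    IsWeaklyMixing (shiftMap P) := by
  rintro U V hU ⟨⟨x₁, x₂⟩, hx⟩ hV ⟨⟨y₁, y₂⟩, hy⟩
  obtain ⟨U₁, U₂, hU₁, hU₂, hx₁, hx₂, hUs⟩ := isOpen_prod_iff.mp hU x₁ x₂ hx
  obtain ⟨V₁, V₂, hV₁, hV₂, hy₁, hy₂, hVs⟩ := isOpen_prod_iff.mp hV y₁ y₂ hy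
  obtain ⟨L₁, h₁⟩ := exists_cylinder_subset hU₁ hx₁
  obtain ⟨L₂, h₂⟩ := exists_cylinder_subset hU₂ hx₂
  obtain ⟨L₃, h₃⟩ := exists_cylinder_subset hV₁ hy₁
  obtain ⟨L₄, h₄⟩ := exists_cylinder_subset hV₂ hy₂
  rw [Set.infinite_iff_exists_gt]
  intro N
  obtain ⟨n, hn, hw⟩ := hP.exists_window (L₁ + L₂ + L₃ + L₄) (N + 1 + (L₁ + L₂ + L₃ + L₄))
  obtain ⟨z₁, hz₁, hz₁'⟩ := exists_concat x₁ y₁ (by omega) hw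
  obtain ⟨z₂, hz₂, hz₂'⟩ := exists_concat x₂ y₂ (by omega) hw
  refine ⟨n, ⟨(z₁, z₂), hUs ⟨h₁ z₁ fun i hi => hz₁ i (by omega),
    h₂ z₂ fun i hi => hz₂ i (by omega)⟩, ?_⟩, by omega⟩
  rw [Set.mem_preimage, Prod.map_iterate]
  exact hVs ⟨h₃ _ fun i hi => hz₁' i (by omega), h₄ _ fun i hi => hz₂' i (by omega)⟩

/-! ### An almost disjoint family -/

/-- The code of the first `n` terms of `z`, tagged with `q`. The sets `{code q z n | n}` form an
almost disjoint family. -/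
def code (q : ℕ × ℕ) (z : ℕ → Bool) (n : ℕ) : ℕ :=
  Encodable.encode ((q, ⟨n, fun i => z i⟩) : (ℕ × ℕ) × (Σ n : ℕ, Fin n → Bool))

theorem code_eq_iff {q q' : ℕ × ℕ} {z z' : ℕ → Bool} {n n' : ℕ} :
    code q z n = code q' z' n' ↔ q = q' ∧ n = n' ∧ ∀ i < n, z i = z' i := by
  unfold code
  rw [Encodable.encode_inj, Prod.mk.injEq]
  refine and_congr_right fun _ => ⟨fun h => ?_, ?_⟩
  · obtain ⟨rfl, h⟩ := Sigma.mk.inj_iff.mp h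
    exact ⟨rfl, fun i hi => congrFun (eq_of_heq h) ⟨i, hi⟩⟩
  · rintro ⟨rfl, h⟩
    congr 1
    funext i
    exact h i i.2

theorem code_injective (q : ℕ × ℕ) (z : ℕ → Bool) : Function.Injective (code q z) :=
  fun _ _ h => (code_eq_iff.mp h).2.1

/-- Whether `m` is a code of a prefix of `z` depends on finitely many coordinates of `z`; continuity
of `point` rests on this. -/
theorem isClopen_mem_range_code (q : ℕ × ℕ) (m : ℕ) :
    IsClopen {z : ℕ → Bool | m ∈ Set.range (code q z)} := by
  by_cases h : ∃ z₀ n, code q z₀ n = m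
  · obtain ⟨z₀, n, rfl⟩ := h
    have : {z : ℕ → Bool | code q z₀ n ∈ Set.range (code q z)} =
        (fun z : ℕ → Bool => fun i : Fin n => z i) ⁻¹' {fun i : Fin n => z₀ i} := by
      ext z
      constructor
      · rintro ⟨n', h⟩
        obtain ⟨-, rfl, h'⟩ := code_eq_iff.mp h
        exact funext fun i => h' i i.2
      · intro h
        exact ⟨n, code_eq_iff.mpr ⟨rfl, rfl, fun i hi => congrFun (show _ = _ from h) ⟨i, hi⟩⟩⟩
    rw [this]
    exact (isClopen_discrete _).preimage (continuous_pi fun i => continuous_apply _)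
  · convert isClopen_empty
    rw [Set.eq_empty_iff_forall_notMem]
    rintro z ⟨n, hn⟩
    exact h ⟨z, n, hn⟩

/-! ### The scrambled set -/

/-- A very sparse sequence all of whose differences lie robustly in `P`. -/
structure IsSkeleton (P : Set ℕ) (a : ℕ → ℕ) : Prop where
  gap : ∀ n, a n + 2 * n + 1 ≤ a (n + 1)
  sub_mem : ∀ n i, i ≤ a n → a (n + 1) - i ∈ P

theorem IsThick.exists_isSkeleton {P : Set ℕ} (hP : IsThick P) : ∃ a, IsSkeleton P a := by
  choose g hg hg' using hP.exists_window
  -- The next term is the centre of a window in `P` of radius `b`, so subtracting any `i ≤ b` from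
  -- it stays in `P`.
  let a : ℕ → ℕ := fun n => Nat.rec 0 (fun n b => g b (b + 2 * n + 1)) n
  have ha : ∀ n, a (n + 1) = g (a n) (a n + 2 * n + 1) := fun _ => rfl
  have hgap : ∀ n, a n + 2 * n + 1 ≤ a (n + 1) := fun n => by
    rw [ha]
    exact hg _ _
  refine ⟨a, hgap, fun n i hi => ?_⟩
  have := hgap n
  rw [ha] at this ⊢
  exact hg' (a n) (a n + 2 * n + 1) _ (by omega) (by omega)

namespace IsSkeleton

variable {P : Set ℕ} {a : ℕ → ℕ}

theorem strictMono (ha : IsSkeleton P a) : StrictMono a :=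
  strictMono_nat_of_lt_succ fun n => by have := ha.gap n; omega

theorem sub_mem_of_lt (ha : IsSkeleton P a) {m i n : ℕ} (hn : n < m) (hi : i ≤ a n) :
    a m - i ∈ P := by
  obtain ⟨k, rfl⟩ := Nat.exists_eq_add_of_lt hn
  exact ha.sub_mem _ _ (hi.trans (ha.strictMono.monotone (by omega)))

/-- A coincidence `a m - j = a m' - j'` with `m ≠ m'` would need a gap next to `a m` no larger than
`j` or `j'`, but both neighbouring gaps are larger. -/
theorem eq_of_add_eq (ha : IsSkeleton P a) {m m' j j' : ℕ} (hm : j + j' < m)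
    (h : a m + j' = a m' + j) : m = m' ∧ j = j' := by
  rcases lt_trichotomy m m' with hlt | rfl | hlt
  · have h1 := ha.gap m
    have h2 : a (m + 1) ≤ a m' := ha.strictMono.monotone hlt
    omega
  · exact ⟨rfl, by omega⟩
  · obtain ⟨k, rfl⟩ := Nat.exists_eq_add_of_lt hlt
    have h1 := ha.gap (m' + k)
    have h2 : a m' ≤ a (m' + k) := ha.strictMono.monotone (by omega)
    omega

/-- The point that follows `D q.1` up to time `q.2`, and from then on has its ones exactly at the
times `a m` with `m` in the member of the almost disjoint family determined by `q` and `z`. -/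
noncomputable def point (ha : IsSkeleton P a) (D : ℕ → Space P) (q : ℕ × ℕ) (z : ℕ → Bool) :
    Space P := by
  classical
  exact ⟨fun i => (decide (i < q.2) && (D q.1).1 i) ||
      decide (∃ m, q.2 < m ∧ a m = i ∧ m ∈ Set.range (code q z)), by
    refine mem_carrier_of_lt fun i j hij hi hj => ?_
    simp only [Bool.or_eq_true, Bool.and_eq_true, decide_eq_true_eq] at hi hj
    rcases hj with ⟨hj, hj'⟩ | ⟨m, hm, rfl, -⟩
    · rcases hi with ⟨hi, hi'⟩ | ⟨m, hm, rfl, -⟩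
      · exact mem_of_ones _ hij hi' hj'
      · have := ha.strictMono.le_apply (x := m)
        omega
    · rcases hi with ⟨hi, hi'⟩ | ⟨n, hn, rfl, -⟩
      -- Here the condition `q.2 < m` matters: the prefix one satisfies `i < q.2 ≤ a q.2`.
      · exact ha.sub_mem_of_lt hm (hi.le.trans ha.strictMono.le_apply)
      · exact ha.sub_mem_of_lt (ha.strictMono.lt_iff_lt.mp hij) le_rfl⟩

variable (ha : IsSkeleton P a) (D : ℕ → Space P)

theorem point_apply_eq_true_iff (q : ℕ × ℕ) (z : ℕ → Bool) (i : ℕ) :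
    (ha.point D q z).1 i = true ↔ (i < q.2 ∧ (D q.1).1 i = true) ∨
      ∃ m, q.2 < m ∧ a m = i ∧ m ∈ Set.range (code q z) := by
  simp [point]

theorem point_apply_of_lt (q : ℕ × ℕ) (z : ℕ → Bool) {i : ℕ} (hi : i < q.2) :
    (ha.point D q z).1 i = (D q.1).1 i := by
  rw [Bool.eq_iff_iff, point_apply_eq_true_iff]
  constructor
  · rintro (⟨-, h⟩ | ⟨m, hm, rfl, -⟩)
    · exact h
    · have := ha.strictMono.le_apply (x := m)
      omega
  · exact fun h => Or.inl ⟨hi, h⟩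

theorem continuous_point (q : ℕ × ℕ) : Continuous (ha.point D q) := by
  refine continuous_induced_rng.mpr (continuous_pi fun i => ?_)
  have hclopen : IsClopen {z : ℕ → Bool | (ha.point D q z).1 i = true} := by
    by_cases h : ∃ m, q.2 < m ∧ a m = i
    · obtain ⟨m, hm, rfl⟩ := h
      have hlt : ¬ a m < q.2 := by
        have := ha.strictMono.le_apply (x := m)
        omega
      convert isClopen_mem_range_code q m using 1
      ext z
      rw [Set.mem_ofPred_eq, point_apply_eq_true_iff]
      constructor
      · rintro (⟨h, -⟩ | ⟨m', -, h, h'⟩)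
        · exact absurd h hlt
        · rwa [← ha.strictMono.injective h]
      · exact fun h => Or.inr ⟨m, hm, rfl, h⟩
    · by_cases h' : i < q.2 ∧ (D q.1).1 i = true
      · convert isClopen_univ
        rw [Set.eq_univ_iff_forall]
        exact fun z => (ha.point_apply_eq_true_iff D q z i).mpr (Or.inl h')
      · convert isClopen_empty
        rw [Set.eq_empty_iff_forall_notMem]
        intro z hz
        rcases (ha.point_apply_eq_true_iff D q z i).mp hz with h1 | ⟨m, h1, h2, -⟩
        · exact h' h1
        · exact h ⟨m, h1, h2⟩
  exact (continuous_bool_rng true).mpr hclopen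

theorem isSqrtSparse_point (q : ℕ × ℕ) (z : ℕ → Bool) :
    IsSqrtSparse {n | (ha.point D q z).1 n = true} := by
  refine ((isSqrtSparse_of_finite (Set.finite_Iio q.2)).union (isSqrtSparse_range ha.gap)).mono ?_
  intro n hn
  rcases (ha.point_apply_eq_true_iff D q z n).mp hn with h | ⟨m, -, h, -⟩
  · exact Or.inl h.1
  · exact Or.inr ⟨m, h⟩

theorem frequently_ne {q q' : ℕ × ℕ} {z z' : ℕ → Bool} {j j' : ℕ}
    (h : ¬ (q = q' ∧ z = z' ∧ j = j')) :
    ∃ᶠ n in atTop, ((shiftMap P)^[j] (ha.point D q z)).1 n ≠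
      ((shiftMap P)^[j'] (ha.point D q' z')).1 n := by
  -- For equal parameters, a shared code forces equal tags, so the labels can differ only in the
  -- shift. For different parameters, long prefixes are never shared.
  have hfin : ∃ K, ∀ t ≥ K, code q z t ∈ Set.range (code q' z') → j ≠ j' := by
    by_cases hz : z = z'
    · refine ⟨0, ?_⟩
      rintro t - ⟨t', ht⟩ hj
      exact h ⟨(code_eq_iff.mp ht).1.symm, hz, hj⟩
    · obtain ⟨i, hi⟩ := Function.ne_iff.mp hz
      refine ⟨i + 1, ?_⟩
      rintro t ht ⟨t', ht'⟩ -
      obtain ⟨-, rfl, h3⟩ := code_eq_iff.mp ht'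
      exact hi (h3 i (by omega)).symm
  obtain ⟨K, hK⟩ := hfin
  rw [frequently_atTop]
  intro N
  -- A code this large places the one of the first point after time `N` and beyond both prefixes,
  -- and meets the bound `j + j' < m` of `eq_of_add_eq`.
  obtain ⟨t, ht, htK⟩ := (((code_injective q z).nat_tendsto_atTop.eventually_ge_atTop
    (N + j + j' + q.2 + q'.2 + 1)).and (eventually_ge_atTop K)).exists
  have hm := ha.strictMono.le_apply (x := code q z t)
  refine ⟨a (code q z t) - j, by omega, ?_⟩
  rw [shiftMap_iterate_apply, shiftMap_iterate_apply, Nat.sub_add_cancel (by omega)]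
  rw [(ha.point_apply_eq_true_iff D q z _).mpr (Or.inr ⟨_, by omega, rfl, t, rfl⟩)]
  intro heq
  rcases (ha.point_apply_eq_true_iff D q' z' _).mp heq.symm with ⟨h1, -⟩ | ⟨m', h1, h2, h3⟩
  · omega
  · obtain ⟨h4, h5⟩ := ha.eq_of_add_eq (m := code q z t) (m' := m') (j := j) (j' := j')
      (by omega) (by omega)
    rw [← h4] at h3
    exact hK t htK h3 h5

/-- All shifts of all the points `point D q z`. -/
def scrambledSet : Set (Space P) :=
  ⋃ p : (ℕ × ℕ) × ℕ, Set.range fun z => (shiftMap P)^[p.2] (ha.point D p.1 z)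

theorem isCantorSet_range (q : ℕ × ℕ) (j : ℕ) :
    IsCantorSet (Set.range fun z => (shiftMap P)^[j] (ha.point D q z)) := by
  have hc : Continuous fun z => (shiftMap P)^[j] (ha.point D q z) :=
    ((continuous_shiftMap P).iterate j).comp (ha.continuous_point D q)
  have hi : Function.Injective fun z => (shiftMap P)^[j] (ha.point D q z) := by
    intro z z' h
    by_contra hne
    obtain ⟨n, hn⟩ := (ha.frequently_ne D (q := q) (q' := q) (j := j) (j' := j)
      (fun h => hne h.2.1)).exists
    exact hn (congrArg (fun x : Space P => x.1 n) h)
  exact ⟨(hc.isClosedEmbedding hi).isEmbedding.toHomeomorph.symm⟩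

theorem isMycielski_scrambledSet : IsMycielski (ha.scrambledSet D) := by
  obtain ⟨e⟩ : Nonempty (ℕ ≃ (ℕ × ℕ) × ℕ) := ⟨(Denumerable.eqv _).symm⟩
  refine ⟨fun n => Set.range fun z => (shiftMap P)^[(e n).2] (ha.point D (e n).1 z),
    fun n => ha.isCantorSet_range D _ _, ?_⟩
  exact (e.surjective.iUnion_comp
    fun p => Set.range fun z => (shiftMap P)^[p.2] (ha.point D p.1 z)).symm

theorem mapsTo_scrambledSet :
    Set.MapsTo (shiftMap P) (ha.scrambledSet D) (ha.scrambledSet D) := by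
  intro x hx
  obtain ⟨p, z, rfl⟩ := Set.mem_iUnion.mp hx
  exact Set.mem_iUnion.mpr ⟨(p.1, p.2 + 1), z, Function.iterate_succ_apply' _ _ _⟩

theorem dense_scrambledSet (hD : DenseRange D) : Dense (ha.scrambledSet D) := by
  rw [dense_iff_inter_open]
  rintro U hU hne
  obtain ⟨k, hk⟩ := hD.exists_mem_open hU hne
  obtain ⟨L, hL⟩ := exists_cylinder_subset hU hk
  -- The tag ranges over all pairs, so every prefix of every `D k` is copied by some point.
  exact ⟨ha.point D (k, L) fun _ => false, hL _ fun i hi => ha.point_apply_of_lt D (k, L) _ hi,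
    Set.mem_iUnion.mpr ⟨((k, L), 0), _, rfl⟩⟩

theorem isBanachScrambled_scrambledSet :
    IsBanachScrambled (shiftMap P) (ha.scrambledSet D) := by
  refine ⟨?_, ?_⟩
  -- A point and its own shift already have different labels.
  · refine ⟨_, Set.mem_iUnion.mpr ⟨((0, 0), 0), fun _ => false, rfl⟩,
      _, Set.mem_iUnion.mpr ⟨((0, 0), 1), fun _ => false, rfl⟩, fun h => ?_⟩
    obtain ⟨n, hn⟩ := (ha.frequently_ne D (q := (0, 0)) (q' := (0, 0)) (z := fun _ => false)
      (z' := fun _ => false) (j := 0) (j' := 1) (by simp)).exists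
    exact hn (congrArg (fun x : Space P => x.1 n) h)
  · intro x hx y hy hxy
    obtain ⟨⟨q, j⟩, z, rfl⟩ := Set.mem_iUnion.mp hx
    obtain ⟨⟨q', j'⟩, z', rfl⟩ := Set.mem_iUnion.mp hy
    refine ⟨isBanachProximal_of_isSqrtSparse ?_ ?_, not_isAsymptotic_of_frequently_ne
      (ha.frequently_ne D fun h => hxy ?_)⟩
    · simp only [shiftMap_iterate_apply]
      exact (ha.isSqrtSparse_point D q z).preimage_add j
    · simp only [shiftMap_iterate_apply]
      exact (ha.isSqrtSparse_point D q' z').preimage_add j'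
    · obtain ⟨rfl, rfl, rfl⟩ := h
      rfl

end IsSkeleton

end SpacingShift

theorem theorem6p5 (P : Set ℕ) (hP : 0 ∉ P) :
    (SpacingShift.IsWeaklyMixing (SpacingShift.shiftMap P) ↔ SpacingShift.IsThick P) ∧
    (SpacingShift.IsWeaklyMixing (SpacingShift.shiftMap P) →
      ∃ S : Set (SpacingShift.Space P),
        Dense S ∧ SpacingShift.IsMycielski S ∧ Set.MapsTo (SpacingShift.shiftMap P) S S ∧
        SpacingShift.IsBanachScrambled (SpacingShift.shiftMap P) S) := by
  refine ⟨⟨SpacingShift.isThick_of_isWeaklyMixing, SpacingShift.isWeaklyMixing_of_isThick⟩,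
    fun h => ?_⟩
  obtain ⟨a, ha⟩ := (SpacingShift.isThick_of_isWeaklyMixing h).exists_isSkeleton
  have : Nonempty (SpacingShift.Space P) := (SpacingShift.nonempty_coord P 0).to_type
  exact ⟨ha.scrambledSet (TopologicalSpace.denseSeq _),
    ha.dense_scrambledSet _ (TopologicalSpace.denseRange_denseSeq _),
    ha.isMycielski_scrambledSet _, ha.mapsTo_scrambledSet _, ha.isBanachScrambled_scrambledSet _⟩
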